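/- All graphs are finite and simple. Let $T$ be a tree with at least two vertices. For sets $U,W$ of vertices of $T$ put $d_T(U,W)=\min\{d_T(u,w):u\in U,\ w\in W\}$. The center $C(T)$ is the set of vertices of minimum eccentricity. The centroid $C_d(T)$ is the set of vertices of minimum weight, where the weight of $v$ is the maximal number of edges in a branch at $v$, i.e. in a maximal subtree of $T$ containing $v$ as a pendant vertex (a vertex of degree $1$). The subtree core $S_c(T)$ is the set of vertices $v$ that are contained in the maximal number of subtrees of $T$. A Fiedler vector of $T$ is an eigenvector $Y$ of the Laplacian matrix of $T$ for its second smallest eigenvalue (counted with multiplicity). The characteristic set $\chi(T)$ consists of the vertices $v$ with $Y(v)=0$ that have a neighbour $u$ with $Y(u)\neq 0$, and of both ends of every edge $\{u,v\}$ with $Y(u)Y(v)<0$; it is known that it does not depend on the choice of the Fiedler vector $Y$. Let $3\le k\le n-1$, and let $T_{n,k}$ be the graph obtained from the path $[v_1,v_2,\ldots,v_{k+1}]$ by attaching $n-k-1$ pendant vertices at $v_{\lfloor (k+2)/2\rfloor}$. Then $T_{n,k}$ is a tree on $n$ vertices with diameter $k$, it has a Fiedler vector, and (for $\chi$ formed with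 any Fiedler vector of $T_{n,k}$), writing $T=T_{n,k}$, $$d_{T}(C,C_d)=d_{T}(C,S_c)=d_{T}(C_d,S_c)=d_{T}(C,\chi)=d_{T}(C_d,\chi)=d_{T}(\chi,S_c)=0.$$ Consequently, for each pair of distinct central parts among center, centroid, subtree core and characteristic set, the minimum of the distance between the two parts over all trees on $n$ vertices with diameter $k$ is $0$. -/

import Mathlib

namespace TreeCentralParts

variable {V : Type*}

/-- The distance `d(U, W) = min {d(u, w) : u ∈ U, w ∈ W}` between two sets of vertices, as an
extended natural number (so that it is `⊤`, and not `0`, if one of the sets is empty). -/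
noncomputable def setDist (G : SimpleGraph V) (U W : Set V) : ℕ∞ :=
  ⨅ u ∈ U, ⨅ w ∈ W, G.edist u w

/-- A subtree of `G`: a subgraph that is a tree. -/
def IsSubtree (G : SimpleGraph V) (H : G.Subgraph) : Prop :=
  H.coe.IsTree

/-- `v` is a pendant vertex (a vertex of degree `1`) of the subgraph `H`. -/
def IsPendant (G : SimpleGraph V) (H : G.Subgraph) (v : V) : Prop :=
  ∃! u, H.Adj v u

/-- A branch at `v`: a maximal subtree containing `v` as a pendant vertex. -/
def IsBranch (G : SimpleGraph V) (v : V) (B : G.Subgraph) : Prop :=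
  Maximal (fun H : G.Subgraph => IsSubtree G H ∧ IsPendant G H v) B

/-- The weight of `v`: the maximal number of edges in a branch at `v`. -/
noncomputable def weight (G : SimpleGraph V) (v : V) : ℕ∞ :=
  ⨆ (B : G.Subgraph) (_ : IsBranch G v B), B.edgeSet.encard

/-- The centroid: the set of vertices of minimal weight. -/
def centroid (G : SimpleGraph V) : Set V :=
  {v | ∀ u, weight G v ≤ weight G u}

/-- The number of subtrees containing `v` (for a finite graph). -/
noncomputable def subtreeCount (G : SimpleGraph V) (v : V) : ℕ :=
  {H : G.Subgraph | IsSubtree G H ∧ v ∈ H.verts}.ncard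

/-- The subtree core: the set of vertices contained in the maximal number of subtrees. -/
def subtreeCore (G : SimpleGraph V) : Set V :=
  {v | ∀ u, subtreeCount G u ≤ subtreeCount G v}

open Classical in
/-- `Y` is a Fiedler vector of `G`: an eigenvector of the Laplacian matrix for its second smallest
eigenvalue (eigenvalues counted with multiplicity). `eigenvalues₀` lists the `|V|` eigenvalues in
decreasing order, with indices `0, …, |V| - 1`, so the second smallest has index `|V| - 2`. -/
def IsFiedlerVector [Fintype V] (G : SimpleGraph V) (Y : V → ℝ) : Prop :=
  Y ≠ 0 ∧ ∃ i : Fin (Fintype.card V), (i : ℕ) + 2 = Fintype.card V ∧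
    (G.lapMatrix ℝ).mulVec Y = (G.isHermitian_lapMatrix (R := ℝ)).eigenvalues₀ i • Y

/-- `v` is a characteristic vertex with respect to `Y`. -/
def IsCharVertex (G : SimpleGraph V) (Y : V → ℝ) (v : V) : Prop :=
  Y v = 0 ∧ ∃ u, G.Adj v u ∧ Y u ≠ 0

/-- `{u, v}` is a characteristic edge with respect to `Y`. -/
def IsCharEdge (G : SimpleGraph V) (Y : V → ℝ) (u v : V) : Prop :=
  G.Adj u v ∧ Y u * Y v < 0

/-- The characteristic set with respect to `Y`, as a set of vertices: all characteristic vertices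
and both ends of each characteristic edge. -/
def charSet (G : SimpleGraph V) (Y : V → ℝ) : Set V :=
  {v | IsCharVertex G Y v ∨ ∃ u, IsCharEdge G Y v u}

/-- The trees on `n` (labelled) vertices with diameter `k`. -/
def treesOfDiam (n k : ℕ) : Set (SimpleGraph (Fin n)) :=
  {T | T.IsTree ∧ T.diam = k}

/-- The tree `T_{n,k}` (for `k + 1 ≤ n`). The index `i ≤ k` is the path vertex `v_{i+1}`; the
indices `k + 1, …, n - 1` are the pendant vertices attached at `v_{⌊(k+2)/2⌋}`. -/
def treeT (n k : ℕ) : SimpleGraph (Fin n) :=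
  SimpleGraph.fromRel fun i j =>
    ((j : ℕ) = (i : ℕ) + 1 ∧ (j : ℕ) ≤ k) ∨ ((i : ℕ) + 1 = (k + 2) / 2 ∧ k < (j : ℕ))

end TreeCentralParts

/-! All four central parts of `treeT n k` contain the hub, the vertex of index `k / 2`; hence every
distance in question is `0`, which is trivially the least possible value.

Write `r = k - k / 2`. The hub is within distance `r` of every vertex, while every vertex is at
distance at least `r` from one end of the path; this settles the center. A branch at the hub lives
in one arm, that is, one component left after deleting the hub, so it has at most `r` edges. The
weight of any vertex is at least its eccentricity, because a path starting there extends to a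
branch; this settles the centroid. For the subtree core, reversing the segment between the hub and a
path vertex `u` turns subtrees through `u` that avoid the hub into subtrees through the hub that
avoid `u` (`subtreeCount_le_of_map`).

The characteristic set needs spectral input. Extending the path eigenvector constantly along pendant
edges bounds the Fiedler eigenvalue by `2 - 2 cos (π / (k + 1))` (`eigenvalue_treeT_le`). So it
equals `2 - 2 cos 2α` with `2 (k + 1) α ≤ π`, and on each half of the path a Fiedler vector is a
multiple of `cos ((2 i + 1) α)`, with `i` counted from the end (`eigenvector_treeT`). These cosines
are positive except possibly at the hub, and pendant vertices take the sign of the hub. Since the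
entries sum to `0`, the sign change must happen at the hub. -/

namespace TreeCentralParts

open Matrix

/-! ### Rayleigh quotients and the second smallest Laplacian eigenvalue -/

section Spectral

variable {V : Type*} [Fintype V] [DecidableEq V]

theorem dotProduct_mulVec_eq_sum_eigenvalues {A : Matrix V V ℝ} (hA : A.IsHermitian) (x : V → ℝ) :
    x ⬝ᵥ A *ᵥ x =
      ∑ j, hA.eigenvalues j * (x ⬝ᵥ (hA.eigenvectorBasis j : EuclideanSpace ℝ V)) ^ 2 := by
  have h := (hA.eigenvectorBasis).sum_inner_mul_inner (WithLp.toLp 2 x) (WithLp.toLp 2 (A *ᵥ x))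
  have hs : Aᵀ = A := by simpa using hA.eq
  have h2 : inner ℝ (WithLp.toLp 2 x) (WithLp.toLp 2 (A *ᵥ x)) = x ⬝ᵥ A *ᵥ x := by
    simp [EuclideanSpace.inner_eq_star_dotProduct, dotProduct_comm]
  rw [← h2, ← h]
  refine Finset.sum_congr rfl fun j _ => ?_
  have h3 : (hA.eigenvectorBasis j : EuclideanSpace ℝ V) ⬝ᵥ A *ᵥ x =
      hA.eigenvalues j * (x ⬝ᵥ (hA.eigenvectorBasis j : EuclideanSpace ℝ V)) := by
    rw [dotProduct_mulVec, ← mulVec_transpose, hs, hA.mulVec_eigenvectorBasis, smul_dotProduct,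
      dotProduct_comm, smul_eq_mul]
  have h4 : inner ℝ (WithLp.toLp 2 x) (hA.eigenvectorBasis j) =
      x ⬝ᵥ (hA.eigenvectorBasis j : EuclideanSpace ℝ V) := by
    simp [EuclideanSpace.inner_eq_star_dotProduct, dotProduct_comm]
  have h5 : inner ℝ (hA.eigenvectorBasis j) (WithLp.toLp 2 (A *ᵥ x)) =
      (hA.eigenvectorBasis j : EuclideanSpace ℝ V) ⬝ᵥ A *ᵥ x := by
    simp [EuclideanSpace.inner_eq_star_dotProduct, dotProduct_comm]
  rw [h4, h5, h3]
  ring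

theorem dotProduct_self_eq_sum {A : Matrix V V ℝ} (hA : A.IsHermitian) (x : V → ℝ) :
    x ⬝ᵥ x = ∑ j, (x ⬝ᵥ (hA.eigenvectorBasis j : EuclideanSpace ℝ V)) ^ 2 := by
  have h := (hA.eigenvectorBasis).sum_inner_mul_inner (WithLp.toLp 2 x) (WithLp.toLp 2 x)
  have h2 : inner ℝ (WithLp.toLp 2 x) (WithLp.toLp 2 x) = x ⬝ᵥ x := by
    rw [EuclideanSpace.inner_eq_star_dotProduct]; rfl
  rw [← h2, ← h]
  refine Finset.sum_congr rfl fun j _ => ?_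
  simp [EuclideanSpace.inner_eq_star_dotProduct, dotProduct_comm, sq]

/-- The second smallest eigenvalue is a lower bound for the Rayleigh quotient of some nonzero
combination of any two vectors. -/
theorem exists_eigenvalue_mul_le {A : Matrix V V ℝ} (hA : A.IsHermitian)
    {i : Fin (Fintype.card V)} (hi : (i : ℕ) + 2 = Fintype.card V) (u w : V → ℝ) :
    ∃ a b : ℝ, (a ≠ 0 ∨ b ≠ 0) ∧
      hA.eigenvalues₀ i * ((a • u + b • w) ⬝ᵥ (a • u + b • w)) ≤
        (a • u + b • w) ⬝ᵥ A *ᵥ (a • u + b • w) := by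
  set e := Fintype.equivOfCardEq (Fintype.card_fin (Fintype.card V))
  let l : Fin (Fintype.card V) := ⟨i + 1, by omega⟩
  let v : V → ℝ := (hA.eigenvectorBasis (e l) : EuclideanSpace ℝ V)
  -- One linear condition on two coefficients: some nontrivial combination is orthogonal to the
  -- eigenvector `v` of the smallest eigenvalue, and all remaining eigenvalues are at least the one
  -- of index `i`.
  obtain ⟨a, b, hab, h0⟩ : ∃ a b : ℝ, (a ≠ 0 ∨ b ≠ 0) ∧ (a • u + b • w) ⬝ᵥ v = 0 := by
    by_cases h : u ⬝ᵥ v = 0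
    · exact ⟨1, 0, by simp, by simp [h]⟩
    · exact ⟨w ⬝ᵥ v, -(u ⬝ᵥ v), Or.inr (neg_ne_zero.2 h), by
        simp only [add_dotProduct, smul_dotProduct, smul_eq_mul]; ring⟩
  refine ⟨a, b, hab, ?_⟩
  rw [dotProduct_mulVec_eq_sum_eigenvalues hA, dotProduct_self_eq_sum hA, Finset.mul_sum]
  refine Finset.sum_le_sum fun j _ => ?_
  by_cases hj : e.symm j = l
  · have : j = e l := by rw [← hj, Equiv.apply_symm_apply]
    subst this
    change _ * ((a • u + b • w) ⬝ᵥ v) ^ 2 ≤ _ * ((a • u + b • w) ⬝ᵥ v) ^ 2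
    simp [h0]
  · refine mul_le_mul_of_nonneg_right (hA.eigenvalues₀_antitone ?_) (sq_nonneg _)
    change e.symm j ≤ i
    have h1 := (e.symm j).isLt
    have h2 : ((e.symm j : Fin _) : ℕ) ≠ i + 1 := fun h => hj (Fin.ext h)
    rw [Fin.le_def]
    omega

/-- The second smallest Laplacian eigenvalue of a connected graph is positive. -/
theorem eigenvalue_lapMatrix_pos {G : SimpleGraph V} [DecidableRel G.Adj] (hG : G.Connected)
    {i : Fin (Fintype.card V)} (hi : (i : ℕ) + 2 = Fintype.card V) :
    0 < (G.isHermitian_lapMatrix (R := ℝ)).eigenvalues₀ i := by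
  set hA := G.isHermitian_lapMatrix (R := ℝ)
  have hps := SimpleGraph.posSemidef_lapMatrix ℝ G
  set e := Fintype.equivOfCardEq (Fintype.card_fin (Fintype.card V))
  have hnn : ∀ j, 0 ≤ hA.eigenvalues₀ j := fun j => by
    have := hps.eigenvalues_nonneg (e j)
    simpa [Matrix.IsHermitian.eigenvalues, e] using this
  let l : Fin (Fintype.card V) := ⟨i + 1, by omega⟩
  refine (hnn i).lt_of_ne' fun h0 => ?_
  have hl : hA.eigenvalues₀ l = 0 :=
    le_antisymm (h0 ▸ hA.eigenvalues₀_antitone (by simp [l, Fin.le_def])) (hnn l)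
  -- By connectedness, kernel vectors are constant. If the eigenvalue of index `i` vanished, there
  -- would be two orthogonal nonzero constant vectors.
  have hconst : ∀ j, hA.eigenvalues₀ j = 0 → ∃ r : ℝ, r ≠ 0 ∧
      ∀ v, (hA.eigenvectorBasis (e j) : EuclideanSpace ℝ V) v = r := by
    intro j hj
    have h1 := hA.mulVec_eigenvectorBasis (e j)
    have h2 : hA.eigenvalues (e j) = 0 := by simpa [Matrix.IsHermitian.eigenvalues, e] using hj
    rw [h2, zero_smul, SimpleGraph.lapMatrix_mulVec_eq_zero_iff_forall_reachable] at h1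
    obtain ⟨v₀⟩ := hG.nonempty
    refine ⟨(hA.eigenvectorBasis (e j) : EuclideanSpace ℝ V) v₀, fun h => ?_,
      fun v => h1 _ _ (hG.preconnected v v₀)⟩
    refine hA.eigenvectorBasis.orthonormal.ne_zero (e j) ?_
    ext v
    rw [h1 v v₀ (hG.preconnected v v₀), h]
    rfl
  obtain ⟨r, hr, hr'⟩ := hconst i h0
  obtain ⟨s, hs, hs'⟩ := hconst l hl
  have hil : e i ≠ e l := fun h => by simpa [l, Fin.ext_iff] using e.injective h
  have := hA.eigenvectorBasis.orthonormal.inner_eq_zero hil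
  simp only [PiLp.inner_apply, hr', hs'] at this
  have hc : (Fintype.card V : ℝ) ≠ 0 := by
    rw [Nat.cast_ne_zero]; omega
  simp [hr, hs] at this
  exact hc (by simp [this])

/-- Any two vectors `u`, `w` have a nontrivial combination whose Rayleigh quotient is at least the
eigenvalue of a Fiedler vector. -/
theorem IsFiedlerVector.exists_eigenvalue {G : SimpleGraph V} {Y : V → ℝ}
    [DecidableRel G.Adj]
    (hY : IsFiedlerVector G Y) (hG : G.Connected) :
    ∃ μ : ℝ, 0 < μ ∧ G.lapMatrix ℝ *ᵥ Y = μ • Y ∧ ∀ u w : V → ℝ, ∃ a b : ℝ, (a ≠ 0 ∨ b ≠ 0) ∧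
      μ * ((a • u + b • w) ⬝ᵥ (a • u + b • w)) ≤
        (a • u + b • w) ⬝ᵥ G.lapMatrix ℝ *ᵥ (a • u + b • w) := by
  obtain ⟨-, i, hi, h⟩ := hY
  refine ⟨(G.isHermitian_lapMatrix (R := ℝ)).eigenvalues₀ i, eigenvalue_lapMatrix_pos hG hi, ?_,
    exists_eigenvalue_mul_le _ hi⟩
  convert h

omit [DecidableEq V] in
theorem exists_isFiedlerVector (G : SimpleGraph V) (h : 2 ≤ Fintype.card V) :
    ∃ Y, IsFiedlerVector G Y := by
  classical
  let hA := G.isHermitian_lapMatrix (R := ℝ)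
  let e := Fintype.equivOfCardEq (Fintype.card_fin (Fintype.card V))
  let i : Fin (Fintype.card V) := ⟨Fintype.card V - 2, by omega⟩
  refine ⟨(hA.eigenvectorBasis (e i) : EuclideanSpace ℝ V), fun h0 => ?_, i, by simp [i]; omega, ?_⟩
  · refine hA.eigenvectorBasis.orthonormal.ne_zero (e i) ?_
    ext v
    exact congrFun h0 v
  · have h1 := hA.mulVec_eigenvectorBasis (e i)
    have h2 : hA.eigenvalues (e i) = hA.eigenvalues₀ i := by
      simp [Matrix.IsHermitian.eigenvalues, e]
    rw [h2] at h1
    convert h1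

end Spectral

/-! ### Subtrees, branches and distances in acyclic graphs -/

section Subtrees

variable {V : Type*} {G : SimpleGraph V}

theorem isSubtree_iff_connected (hG : G.IsAcyclic) {H : G.Subgraph} :
    IsSubtree G H ↔ H.Connected :=
  ⟨fun h => H.connected_iff'.2 h.connected, fun h => ⟨H.connected_iff'.1 h, hG.subgraph H⟩⟩

/-- Every edge of an acyclic graph is a bridge, so a walk inside `H` between its ends has to use it.
-/
theorem adj_of_connected_of_isAcyclic (hG : G.IsAcyclic) {H : G.Subgraph} (hH : H.Connected)
    {u v : V} (hu : u ∈ H.verts) (hv : v ∈ H.verts) (huv : G.Adj u v) : H.Adj u v := by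
  obtain ⟨p, hp⟩ := (H.connected_iff_forall_exists_walk_subgraph.1 hH).2 hu hv
  have hb := SimpleGraph.isBridge_iff_forall_walk_mem_edges.1
    (SimpleGraph.isAcyclic_iff_forall_adj_isBridge.1 hG huv) p
  exact hp.2 ((SimpleGraph.Walk.mem_edges_toSubgraph p).2 hb)

theorem eq_of_verts_eq_of_isAcyclic (hG : G.IsAcyclic) {H K : G.Subgraph} (hH : H.Connected)
    (hK : K.Connected) (h : H.verts = K.verts) : H = K := by
  refine SimpleGraph.Subgraph.ext h ?_
  ext u v
  exact ⟨fun a => adj_of_connected_of_isAcyclic hG hK (h ▸ a.fst_mem) (h ▸ a.snd_mem) a.adj_sub,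
    fun a => adj_of_connected_of_isAcyclic hG hH (h ▸ a.fst_mem) (h ▸ a.snd_mem) a.adj_sub⟩

/-- The image of the vertex set of a connected subgraph under a map that preserves its edges
induces a connected subgraph. -/
theorem connected_induce_image {H : G.Subgraph} (hH : H.Connected) (φ : V → V)
    (hφ : ∀ x y, H.Adj x y → G.Adj (φ x) (φ y)) :
    ((⊤ : G.Subgraph).induce (φ '' H.verts)).Connected := by
  rw [← SimpleGraph.connected_induce_iff]
  let f : H.coe →g G.induce (φ '' H.verts) :=
    { toFun := fun x => ⟨φ x, x, x.2, rfl⟩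
      map_rel' := fun {a b} h => hφ a b h }
  refine SimpleGraph.Connected.map f ?_ (H.connected_iff'.1 hH)
  rintro ⟨_, x, hx, rfl⟩
  exact ⟨⟨x, hx⟩, rfl⟩

/-- If the subtrees that contain `u` but not `c` live in a set on which some injective
adjacency-preserving map sends `u` to `c` and avoids `u`, then `c` lies in at least as many subtrees
as `u`. -/
theorem subtreeCount_le_of_map [Finite V] (hG : G.IsAcyclic) {u c : V} (A : Set V) (φ : V → V)
    (hA : ∀ H : G.Subgraph, H.Connected → u ∈ H.verts → c ∉ H.verts → H.verts ⊆ A)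
    (hinj : Set.InjOn φ A) (hadj : ∀ x ∈ A, ∀ y ∈ A, G.Adj x y → G.Adj (φ x) (φ y))
    (hu : φ u = c) (hφ : ∀ x ∈ A, φ x ≠ u) : subtreeCount G u ≤ subtreeCount G c := by
  classical
  have hconn : ∀ H : G.Subgraph, H.Connected → u ∈ H.verts → c ∉ H.verts →
      ((⊤ : G.Subgraph).induce (φ '' H.verts)).Connected := fun H hH h1 h2 =>
    connected_induce_image hH φ fun x y h =>
      hadj x (hA H hH h1 h2 h.fst_mem) y (hA H hH h1 h2 h.snd_mem) h.adj_sub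
  -- Subtrees already containing `c` are kept, the others are replaced by their image under `φ`. The
  -- kept ones contain `u` and the images do not, so the two kinds never collide.
  refine Set.ncard_le_ncard_of_injOn
    (fun H => if c ∈ H.verts then H else (⊤ : G.Subgraph).induce (φ '' H.verts)) ?_ ?_
    (Set.toFinite _)
  · rintro H ⟨hH, huH⟩
    rw [isSubtree_iff_connected hG] at hH
    by_cases hc : c ∈ H.verts
    · simpa [hc, isSubtree_iff_connected hG] using hH
    · simp only [hc, if_false, Set.mem_ofPred_eq, isSubtree_iff_connected hG]
      exact ⟨hconn H hH huH hc, u, huH, hu⟩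
  · rintro H ⟨hH, huH⟩ K ⟨hK, huK⟩ h
    rw [isSubtree_iff_connected hG] at hH hK
    have hmix : ∀ L : G.Subgraph, L.Connected → u ∈ L.verts → c ∉ L.verts →
        u ∉ ((⊤ : G.Subgraph).induce (φ '' L.verts)).verts := by
      rintro L hL huL hcL ⟨x, hx, hxu⟩
      exact hφ x (hA L hL huL hcL hx) hxu
    by_cases hcH : c ∈ H.verts <;> by_cases hcK : c ∈ K.verts <;>
      simp only [hcH, hcK, if_true, if_false] at h
    · exact h
    · exact absurd (h ▸ huH) (hmix K hK huK hcK)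
    · exact absurd (h ▸ huK) (hmix H hH huH hcH)
    · have hv : φ '' H.verts = φ '' K.verts := congrArg SimpleGraph.Subgraph.verts h
      exact eq_of_verts_eq_of_isAcyclic hG hH hK
        ((hinj.image_eq_image_iff (hA H hH huH hcH) (hA K hK huK hcK)).1 hv)

/-- A function that is constant on edges avoiding `c` is constant on a connected subgraph avoiding
`c`. -/
theorem eq_of_connected_of_notMem {α : Type*} {c : V} (g : V → α)
    (hg : ∀ x y, G.Adj x y → x ≠ c → y ≠ c → g x = g y) {H : G.Subgraph} (hH : H.Connected)
    (hc : c ∉ H.verts) {u v : V} (hu : u ∈ H.verts) (hv : v ∈ H.verts) : g u = g v := by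
  obtain ⟨p, hp⟩ := (H.connected_iff_forall_exists_walk_subgraph.1 hH).2 hu hv
  have hp' : ∀ x ∈ p.support, x ≠ c := fun x hx hxc =>
    hc (hxc ▸ hp.1 ((SimpleGraph.Walk.mem_verts_toSubgraph p).2 hx))
  clear hp hu hv
  induction p with
  | nil => rfl
  | cons h q ih =>
    simp only [SimpleGraph.Walk.support_cons, List.mem_cons, forall_eq_or_imp] at hp'
    exact (hg _ _ h hp'.1 (hp'.2 _ q.start_mem_support)).trans (ih hp'.2)

/-- A function that is constant on edges avoiding `c` is constant on the vertices other than `c` of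
a subtree with pendant vertex `c`. -/
theorem eq_of_connected_of_isPendant {α : Type*} {c w : V} (g : V → α)
    (hg : ∀ x y, G.Adj x y → x ≠ c → y ≠ c → g x = g y) {H : G.Subgraph} (hH : H.Connected)
    (hw : H.Adj c w) (huniq : ∀ x, H.Adj c x → x = w) {v : V} (hv : v ∈ H.verts) (hvc : v ≠ c) :
    g v = g w := by
  -- A walk inside `H` enters and leaves `c` only through `w`, so the label survives a passage
  -- through `c`.
  have key : ∀ {x y : V} (p : G.Walk x y), p.toSubgraph ≤ H → y ≠ c →
      (x = c → g y = g w) ∧ (x ≠ c → g y = g x) := by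
    intro x y p
    induction p with
    | nil => exact fun _ h => ⟨fun h' => absurd h' h, fun _ => rfl⟩
    | @cons x z y h q ih =>
      intro hp hy
      rw [SimpleGraph.Walk.toSubgraph, sup_le_iff] at hp
      have hxz : H.Adj x z := hp.1.2 (by simp)
      obtain ⟨h1, h2⟩ := ih hp.2 hy
      refine ⟨?_, fun hx => ?_⟩
      · rintro rfl
        obtain rfl := huniq z hxz
        exact h2 h.ne'
      · by_cases hz : z = c
        · subst hz
          rw [h1 rfl, huniq x hxz.symm]
        · rw [h2 hz, hg x z h hx hz]
  obtain ⟨p, hp⟩ := (H.connected_iff_forall_exists_walk_subgraph.1 hH).2 hw.fst_mem hv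
  exact (key p hp hvc).1 rfl

/-- Here `g` labels the components of `G` without `c`: a branch at `c` stays in the component of its
unique neighbour of `c`. -/
theorem weight_le {c : V} {α : Type*} (g : V → α) {N : ℕ∞}
    (hg : ∀ x y, G.Adj x y → x ≠ c → y ≠ c → g x = g y)
    (hN : ∀ w, G.Adj c w → {e ∈ G.edgeSet | ∀ x ∈ e, x = c ∨ g x = g w}.encard ≤ N) :
    weight G c ≤ N := by
  refine iSup₂_le fun B hB => ?_
  obtain ⟨hB, w, hw, huniq⟩ := hB.prop
  have hsub : B.edgeSet ⊆ {e ∈ G.edgeSet | ∀ x ∈ e, x = c ∨ g x = g w} := by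
    refine fun e he => ⟨B.edgeSet_subset he, fun x hx => ?_⟩
    by_cases hxc : x = c
    · exact Or.inl hxc
    · exact Or.inr (eq_of_connected_of_isPendant g hg (B.connected_iff'.2 hB.connected) hw huniq
        (B.mem_verts_of_mem_edge he hx) hxc)
  exact (Set.encard_le_encard hsub).trans (hN w hw.adj_sub)

/-- A path from `u` to `v` is a subtree with pendant vertex `u`, and it extends to a branch at `u`.
-/
theorem edist_le_weight [Finite V] (hG : G.IsTree) (u v : V) : G.edist u v ≤ weight G u := by
  by_cases huv : u = v
  · simp [huv]
  obtain ⟨p, hp⟩ := hG.connected.exists_isPath u v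
  have hnil : ¬ p.Nil := SimpleGraph.Walk.not_nil_of_ne huv
  have hpend : IsPendant G p.toSubgraph u := by
    have := hp.neighborSet_toSubgraph_startpoint hnil
    refine ⟨p.snd, p.toSubgraph_adj_snd hnil, fun y hy => ?_⟩
    have hy' : y ∈ p.toSubgraph.neighborSet u := hy
    rwa [this] at hy'
  obtain ⟨B, hle, hB⟩ := Finite.exists_le_maximal
    (p := fun H : G.Subgraph => IsSubtree G H ∧ IsPendant G H u)
    ⟨(isSubtree_iff_connected hG.isAcyclic).2 p.toSubgraph_connected, hpend⟩
  refine le_trans ?_ (le_iSup₂ (f := fun (B : G.Subgraph) (_ : IsBranch G u B) =>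
    B.edgeSet.encard) B hB)
  classical
  calc G.edist u v ≤ p.length := SimpleGraph.edist_le p
    _ = (p.edges.toFinset.card : ℕ∞) := by
        rw [List.toFinset_card_of_nodup hp.isTrail.edges_nodup, SimpleGraph.Walk.length_edges]
    _ = (p.edges.toFinset : Set (Sym2 V)).encard := (Set.encard_coe_eq_coe_finsetCard _).symm
    _ ≤ B.edgeSet.encard := Set.encard_le_encard fun e he =>
        SimpleGraph.Subgraph.edgeSet_mono hle
          ((SimpleGraph.Walk.mem_edges_toSubgraph p).2 (by simpa using he))

/-- An integer-valued function that changes by at most one along edges bounds distances below. -/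
theorem le_edist_of_lipschitz (g : V → ℤ) (hg : ∀ x y, G.Adj x y → g y ≤ g x + 1) {u v : V} {d : ℕ}
    (h : g u + d ≤ g v) : (d : ℕ∞) ≤ G.edist u v := by
  refine le_iInf fun p => ?_
  have key : ∀ {x y : V} (p : G.Walk x y), g y ≤ g x + p.length := by
    intro x y p
    induction p with
    | nil => simp
    | cons h q ih =>
      have := hg _ _ h
      rw [SimpleGraph.Walk.length_cons]
      push_cast
      omega
  have := key p
  exact_mod_cast (by omega : (d : ℤ) ≤ p.length)

theorem setDist_eq_zero {U W : Set V} {v : V} (hU : v ∈ U) (hW : v ∈ W) : setDist G U W = 0 :=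
  nonpos_iff_eq_zero.1 <| (iInf₂_le v hU).trans <| (iInf₂_le v hW).trans (by simp)

end Subtrees

/-! ### The tree `treeT n k`: diameter, center, centroid and subtree core -/

section TreeT

variable {n k : ℕ}

theorem treeT_adj {i j : Fin n} : (treeT n k).Adj i j ↔
    ((j : ℕ) = i + 1 ∧ (j : ℕ) ≤ k ∨ (i : ℕ) = k / 2 ∧ k < j) ∨
      ((i : ℕ) = j + 1 ∧ (i : ℕ) ≤ k ∨ (j : ℕ) = k / 2 ∧ k < i) := by
  rw [treeT, SimpleGraph.fromRel_adj, ne_eq, Fin.ext_iff]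
  omega

theorem treeT_edist_le {i j : Fin n} (hij : (i : ℕ) ≤ j) (hj : (j : ℕ) ≤ k) :
    (treeT n k).edist i j ≤ ((j - i : ℕ) : ℕ∞) := by
  obtain ⟨j, hjn⟩ := j
  simp only at hij hj ⊢
  induction j, hij using Nat.le_induction with
  | base => simp
  | succ j hij ih =>
    have hadj : (treeT n k).Adj ⟨j, by omega⟩ ⟨j + 1, hjn⟩ := by
      rw [treeT_adj]; exact Or.inl (Or.inl ⟨rfl, hj⟩)
    calc (treeT n k).edist i ⟨j + 1, hjn⟩
        ≤ (treeT n k).edist i ⟨j, by omega⟩ + (treeT n k).edist ⟨j, by omega⟩ ⟨j + 1, hjn⟩ :=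
          SimpleGraph.edist_triangle
      _ ≤ ((j - i : ℕ) : ℕ∞) + 1 :=
          add_le_add (ih _ (by omega)) (SimpleGraph.edist_eq_one_iff_adj.2 hadj).le
      _ = ((j + 1 - i : ℕ) : ℕ∞) := by
          rw [show j + 1 - (i : ℕ) = j - i + 1 by omega]; push_cast; rfl

/-- The vertex of the path to which the pendant vertices are attached. -/
def hub (hkn : k + 1 ≤ n) : Fin n := ⟨k / 2, by omega⟩

theorem treeT_edist_hub_le (hk : 3 ≤ k) (hkn : k + 1 ≤ n) (v : Fin n) :
    (treeT n k).edist (hub hkn) v ≤ ((k - k / 2 : ℕ) : ℕ∞) := by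
  rcases le_or_gt (v : ℕ) k with hv | hv
  · rcases le_total (v : ℕ) (k / 2) with h | h
    · rw [SimpleGraph.edist_comm]
      refine (treeT_edist_le (j := hub hkn) h (by simp [hub]; omega)).trans ?_
      simp only [hub]
      exact_mod_cast (by omega)
    · refine (treeT_edist_le (i := hub hkn) h hv).trans ?_
      simp only [hub]
      exact_mod_cast (by omega)
  · have : (treeT n k).Adj (hub hkn) v := by
      rw [treeT_adj]; exact Or.inl (Or.inr ⟨rfl, hv⟩)
    rw [SimpleGraph.edist_eq_one_iff_adj.2 this]
    exact_mod_cast (by omega : 1 ≤ k - k / 2)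

theorem treeT_connected (hk : 3 ≤ k) (hkn : k + 1 ≤ n) : (treeT n k).Connected := by
  have h : ∀ v, (treeT n k).Reachable (hub hkn) v := fun v =>
    SimpleGraph.reachable_of_edist_ne_top
      (ne_top_of_le_ne_top (ENat.natCast_ne_top _) (treeT_edist_hub_le hk hkn v))
  have : Nonempty (Fin n) := ⟨hub hkn⟩
  exact ⟨fun u v => (h u).symm.trans (h v)⟩

/-- The neighbour of a vertex other than `0` that is nearer to the vertex `0`. -/
def parent (hkn : k + 1 ≤ n) (j : Fin n) : Fin n :=
  if (j : ℕ) ≤ k then ⟨j - 1, by omega⟩ else hub hkn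

theorem parent_val (hkn : k + 1 ≤ n) (j : Fin n) :
    (parent hkn j : ℕ) = if (j : ℕ) ≤ k then (j : ℕ) - 1 else (k / 2 : ℕ) := by
  rw [parent]
  split_ifs <;> rfl

theorem treeT_edge_eq (hkn : k + 1 ≤ n) {i j : Fin n} (h : (treeT n k).Adj i j) :
    ((j : ℕ) ≠ 0 ∧ i = parent hkn j) ∨ ((i : ℕ) ≠ 0 ∧ j = parent hkn i) := by
  rw [treeT_adj] at h
  simp only [parent, hub, Fin.ext_iff]
  split_ifs <;> simp only <;> omega

/-- Every edge joins some `j ≠ 0` to its parent, so there are at most `n - 1` edges, which for a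
connected graph forces a tree. -/
theorem treeT_isTree (hk : 3 ≤ k) (hkn : k + 1 ≤ n) : (treeT n k).IsTree := by
  rw [SimpleGraph.isTree_iff_connected_and_card]
  refine ⟨treeT_connected hk hkn, le_antisymm ?_
    (treeT_connected hk hkn).card_vert_le_card_edgeSet_add_one⟩
  have hsub : (treeT n k).edgeSet ⊆
      (fun j : Fin n => s(j, parent hkn j)) '' {j | j ≠ ⟨0, by omega⟩} := by
    intro e
    induction e with | h i j =>
    intro h
    rcases treeT_edge_eq hkn (i := i) (j := j) h with ⟨h0, h1⟩ | ⟨h0, h1⟩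
    · exact ⟨j, fun h => h0 (congrArg Fin.val h), by rw [h1, Sym2.eq_swap]⟩
    · exact ⟨i, fun h => h0 (congrArg Fin.val h), by rw [h1]⟩
  have h1 := (Set.ncard_le_ncard hsub (Set.toFinite _)).trans (Set.ncard_image_le (Set.toFinite _))
  have h2 : {j : Fin n | j ≠ ⟨0, by omega⟩}.ncard + 1 = n := by
    have := Set.ncard_add_ncard_compl {(⟨0, by omega⟩ : Fin n)}
    rw [Set.ncard_singleton, Nat.card_fin] at this
    rw [add_comm]
    exact this
  rw [Nat.card_fin]
  change (treeT n k).edgeSet.ncard + 1 ≤ n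
  omega

/-- The position of a vertex along the path, where pendant vertices are placed at the hub. -/
def pos (n k : ℕ) (i : Fin n) : ℤ := if (i : ℕ) ≤ k then i else ((k / 2 : ℕ) : ℤ)

theorem pos_lipschitz (i j : Fin n) (h : (treeT n k).Adj i j) : pos n k j ≤ pos n k i + 1 := by
  rw [treeT_adj] at h
  simp only [pos]
  split_ifs <;> omega

theorem treeT_diam (hk : 3 ≤ k) (hkn : k + 1 ≤ n) : (treeT n k).diam = k := by
  have h1 : (treeT n k).ediam ≤ (k : ℕ∞) := by
    refine SimpleGraph.ediam_le_of_edist_le ?_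
    have hpath : ∀ u v : Fin n, (u : ℕ) ≤ v → (v : ℕ) ≤ k → (treeT n k).edist u v ≤ (k : ℕ∞) :=
      fun u v huv hv => (treeT_edist_le huv hv).trans (by exact_mod_cast (by omega))
    have hpend : ∀ u v : Fin n, k < (v : ℕ) → (treeT n k).edist u v ≤ (k : ℕ∞) := by
      intro u v hv
      have hadj : (treeT n k).Adj (hub hkn) v := by
        rw [treeT_adj]; exact Or.inl (Or.inr ⟨rfl, hv⟩)
      calc (treeT n k).edist u v
          ≤ (treeT n k).edist u (hub hkn) + (treeT n k).edist (hub hkn) v :=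
            SimpleGraph.edist_triangle
        _ ≤ ((k - k / 2 : ℕ) : ℕ∞) + 1 := by
            rw [SimpleGraph.edist_comm, SimpleGraph.edist_eq_one_iff_adj.2 hadj]
            exact add_le_add (treeT_edist_hub_le hk hkn u) le_rfl
        _ ≤ k := by exact_mod_cast (by omega : k - k / 2 + 1 ≤ k)
    intro u v
    rcases le_or_gt (v : ℕ) k with hv | hv
    · rcases le_or_gt (u : ℕ) k with hu | hu
      · rcases le_total (u : ℕ) v with h | h
        · exact hpath u v h hv
        · rw [SimpleGraph.edist_comm]; exact hpath v u h hu
      · rw [SimpleGraph.edist_comm]; exact hpend v u hu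
    · exact hpend u v hv
  have h2 : (k : ℕ∞) ≤ (treeT n k).ediam :=
    (le_edist_of_lipschitz (pos n k) pos_lipschitz (u := ⟨0, by omega⟩) (v := ⟨k, by omega⟩)
      (by simp [pos])).trans SimpleGraph.edist_le_ediam
  rw [SimpleGraph.diam, le_antisymm h1 h2, ENat.toNat_natCast]

theorem treeT_exists_le_edist (hkn : k + 1 ≤ n) (u : Fin n) :
    ∃ v, ((k - k / 2 : ℕ) : ℕ∞) ≤ (treeT n k).edist u v := by
  rcases le_or_gt (pos n k u) (k / 2 : ℕ) with h | h
  · refine ⟨⟨k, by omega⟩, le_edist_of_lipschitz (pos n k) pos_lipschitz ?_⟩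
    simp only [pos] at h ⊢
    split_ifs at h ⊢ <;> omega
  · refine ⟨⟨0, by omega⟩, ?_⟩
    rw [SimpleGraph.edist_comm]
    refine le_edist_of_lipschitz (pos n k) pos_lipschitz ?_
    simp only [pos] at h ⊢
    split_ifs at h ⊢ <;> omega

theorem hub_mem_center (hk : 3 ≤ k) (hkn : k + 1 ≤ n) : hub hkn ∈ (treeT n k).center := by
  rw [SimpleGraph.mem_center_iff]
  refine le_antisymm (le_iInf fun u => ?_) SimpleGraph.radius_le_eccent
  obtain ⟨v, hv⟩ := treeT_exists_le_edist hkn u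
  exact (((treeT n k).eccent_le_iff _ _).2 (treeT_edist_hub_le hk hkn)).trans
    (hv.trans SimpleGraph.edist_le_eccent)

/-- A label of the component of a vertex in the tree without its hub. -/
def arm (k : ℕ) (i : Fin n) : ℕ :=
  if (i : ℕ) < k / 2 then 0 else if (i : ℕ) ≤ k then 1 else i

theorem arm_eq (hkn : k + 1 ≤ n) (i j : Fin n) (h : (treeT n k).Adj i j) (hi : i ≠ hub hkn)
    (hj : j ≠ hub hkn) : arm k i = arm k j := by
  rw [treeT_adj] at h
  simp only [hub, ne_eq, Fin.ext_iff] at hi hj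
  simp only [arm]
  split_ifs <;> omega

theorem weight_hub_le (hk : 3 ≤ k) (hkn : k + 1 ≤ n) :
    weight (treeT n k) (hub hkn) ≤ ((k - k / 2 : ℕ) : ℕ∞) := by
  refine weight_le (arm k) (arm_eq hkn) fun w hw => ?_
  -- Edges are indexed by their end `j` that is the child. The arm of `w`, together with the hub,
  -- only uses `j` in `(0, k / 2]`, in `(k / 2, k]`, or `j = w`, according to the kind of `w`.
  obtain ⟨a, b, hab, hsub⟩ : ∃ a b : ℕ, b ≤ a + (k - k / 2) ∧ ∀ j : Fin n, (j : ℕ) ≠ 0 →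
      (j = hub hkn ∨ arm k j = arm k w) → (parent hkn j = hub hkn ∨ arm k (parent hkn j) = arm k w) →
      a < (j : ℕ) ∧ (j : ℕ) ≤ b := by
    rw [treeT_adj] at hw
    simp only [hub] at hw
    refine ⟨if (w : ℕ) < k / 2 then 0 else if (w : ℕ) ≤ k then k / 2 else w - 1,
      if (w : ℕ) < k / 2 then k / 2 else if (w : ℕ) ≤ k then k else w, ?_, ?_⟩
    · split_ifs <;> omega
    · intro j hj h1 h2
      have hp := parent_val hkn j
      simp only [hub, arm, Fin.ext_iff] at h1 h2
      rcases h1 with h1 | h1 <;> rcases h2 with h2 | h2 <;> split_ifs at h1 h2 hp ⊢ <;> omega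
  have hE : {e ∈ (treeT n k).edgeSet | ∀ x ∈ e, x = hub hkn ∨ arm k x = arm k w} ⊆
      (fun j : Fin n => s(j, parent hkn j)) '' ((fun j : Fin n => (j : ℕ)) ⁻¹' Set.Ioc a b) := by
    rintro e ⟨he, h⟩
    induction e with | h i j =>
    rcases treeT_edge_eq hkn (i := i) (j := j) he with ⟨h0, h1⟩ | ⟨h0, h1⟩
    · exact ⟨j, hsub j h0 (h j (by simp)) (h1 ▸ h i (by simp)), by rw [h1, Sym2.eq_swap]⟩
    · exact ⟨i, hsub i h0 (h i (by simp)) (h1 ▸ h j (by simp)), by rw [h1]⟩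
  calc _ ≤ _ := Set.encard_le_encard hE
    _ ≤ ((fun j : Fin n => (j : ℕ)) ⁻¹' Set.Ioc a b).encard := Set.encard_image_le _ _
    _ ≤ (Set.Ioc a b).encard :=
        (Fin.val_injective.encard_image _).symm.le.trans
          (Set.encard_le_encard (Set.image_preimage_subset _ _))
    _ = ((b - a : ℕ) : ℕ∞) := by
        rw [← Finset.coe_Ioc, Set.encard_coe_eq_coe_finsetCard, Nat.card_Ioc]
    _ ≤ _ := by exact_mod_cast (by omega)

theorem hub_mem_centroid (hk : 3 ≤ k) (hkn : k + 1 ≤ n) : hub hkn ∈ centroid (treeT n k) := by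
  intro u
  obtain ⟨v, hv⟩ := treeT_exists_le_edist hkn u
  exact (weight_hub_le hk hkn).trans (hv.trans (edist_le_weight (treeT_isTree hk hkn) u v))

theorem hub_mem_subtreeCore (hk : 3 ≤ k) (hkn : k + 1 ≤ n) :
    hub hkn ∈ subtreeCore (treeT n k) := by
  intro u
  by_cases huc : u = hub hkn
  · rw [huc]
  have huc' : (u : ℕ) ≠ k / 2 := fun h => huc (Fin.ext h)
  -- The reflection exchanging `u` and the hub. On the arm of `u` it stays within the indices `0, …,
  -- k`, so the `min` only matters elsewhere. A pendant `u` is alone in its arm and goes to the hub.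
  let φ : Fin n → Fin n := fun i =>
    if h : (u : ℕ) ≤ k then ⟨min (k / 2 + u - i) k, by omega⟩ else hub hkn
  refine subtreeCount_le_of_map (treeT_isTree hk hkn).isAcyclic
    {i | i ≠ hub hkn ∧ arm k i = arm k u} φ ?_ ?_ ?_ ?_ ?_
  · intro H hH hu hc i hi
    exact ⟨fun h => hc (h ▸ hi), eq_of_connected_of_notMem (arm k) (arm_eq hkn) hH hc hi hu⟩
  · rintro i ⟨hi, hi'⟩ j ⟨hj, hj'⟩ h
    simp only [ne_eq, hub, Fin.ext_iff, arm, φ] at *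
    split_ifs at * <;> simp only at * <;> omega
  · rintro i ⟨hi, hi'⟩ j ⟨hj, hj'⟩ h
    rw [treeT_adj] at *
    simp only [ne_eq, hub, Fin.ext_iff, arm, φ] at *
    split_ifs at * <;> simp only at * <;> omega
  · simp only [hub, Fin.ext_iff, φ]
    split_ifs
    · simp only
      omega
    · rfl
  · rintro i ⟨hi, hi'⟩
    simp only [ne_eq, hub, Fin.ext_iff, arm, φ] at *
    split_ifs at * <;> simp only at * <;> omega

end TreeT

/-! ### The cosine eigenvectors of a path -/

section CosSeq

/-- The eigenvector `i ↦ cos ((2 i + 1) α)` of the Laplacian of a path. -/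
noncomputable def cosSeq (α : ℝ) (i : ℕ) : ℝ := Real.cos ((2 * i + 1) * α)

/-- The eigenvector equation at the end of the path: extended to index `-1`, the sequence would
repeat its value at `0`, as cosine is even. -/
theorem cosSeq_one (α : ℝ) : cosSeq α 1 = (2 * Real.cos (2 * α) - 1) * cosSeq α 0 := by
  have h := Real.cos_add_cos ((2 * 1 + 1) * α) (-α)
  rw [Real.cos_neg, show ((2 * 1 + 1) * α + -α) / 2 = α by ring,
    show ((2 * 1 + 1) * α - -α) / 2 = 2 * α by ring] at h
  simp only [cosSeq, Nat.cast_one, Nat.cast_zero, mul_zero, zero_add, one_mul]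
  linarith

theorem cosSeq_add_two (α : ℝ) (i : ℕ) :
    cosSeq α (i + 2) = 2 * Real.cos (2 * α) * cosSeq α (i + 1) - cosSeq α i := by
  have h := Real.cos_add_cos ((2 * (i + 2 : ℝ) + 1) * α) ((2 * i + 1) * α)
  rw [show ((2 * (i + 2 : ℝ) + 1) * α + (2 * i + 1) * α) / 2 = (2 * (i + 1 : ℝ) + 1) * α by ring,
    show ((2 * (i + 2 : ℝ) + 1) * α - (2 * i + 1) * α) / 2 = 2 * α by ring] at h
  simp only [cosSeq]
  push_cast
  linarith

theorem sum_cosSeq (α : ℝ) (j : ℕ) :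
    (2 - 2 * Real.cos (2 * α)) * ∑ i ∈ Finset.range (j + 1), cosSeq α i =
      cosSeq α j - cosSeq α (j + 1) := by
  induction j with
  | zero => rw [Finset.sum_range_one, zero_add, cosSeq_one]; ring
  | succ j ih => rw [Finset.sum_range_succ, mul_add, ih, cosSeq_add_two]; ring

/-- Summation by parts; the boundary term vanishes when the sequence also takes equal values at `j`
and `j + 1`. -/
theorem sum_sq_cosSeq (α : ℝ) (j : ℕ) :
    ∑ i ∈ Finset.range j, (cosSeq α i - cosSeq α (i + 1)) ^ 2 =
      (2 - 2 * Real.cos (2 * α)) * ∑ i ∈ Finset.range (j + 1), cosSeq α i ^ 2 -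
        cosSeq α j * (cosSeq α j - cosSeq α (j + 1)) := by
  induction j with
  | zero => rw [Finset.sum_range_one, Finset.sum_range_zero, zero_add, cosSeq_one]; ring
  | succ j ih =>
    rw [Finset.sum_range_succ, ih, Finset.sum_range_succ _ (j + 1), cosSeq_add_two]; ring

/-- The recurrence and the end condition leave only the value at `0` free, and `cosSeq α 0 = cos α`.
-/
theorem eq_mul_cosSeq {α : ℝ} (hα : Real.cos α ≠ 0) {y : ℕ → ℝ} {N : ℕ} (hN : 1 ≤ N)
    (h₁ : y 1 = (2 * Real.cos (2 * α) - 1) * y 0)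
    (h₂ : ∀ i, i + 2 ≤ N → y (i + 2) = 2 * Real.cos (2 * α) * y (i + 1) - y i) :
    ∀ i ≤ N, y i = y 0 / Real.cos α * cosSeq α i := by
  have h0 : cosSeq α 0 = Real.cos α := by simp [cosSeq]
  have key : ∀ i, i + 1 ≤ N → y i = y 0 / Real.cos α * cosSeq α i ∧
      y (i + 1) = y 0 / Real.cos α * cosSeq α (i + 1) := by
    intro i
    induction i with
    | zero =>
      intro _
      have h : y 0 = y 0 / Real.cos α * cosSeq α 0 := by rw [h0]; field_simp
      refine ⟨h, ?_⟩
      rw [zero_add, h₁, cosSeq_one]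
      conv_lhs => rw [h]
      ring
    | succ i ih =>
      intro hi
      obtain ⟨ha, hb⟩ := ih (by omega)
      refine ⟨hb, ?_⟩
      rw [h₂ i hi, cosSeq_add_two, ha, hb]
      ring
  intro i hi
  rcases i with _ | i
  · exact (key 0 hN).1
  · exact (key i hi).2

/-- The angle `(2 i + 1) α` is at most `k α`, which is below `(k + 1) α ≤ π / 2` unless `α = 0`. -/
theorem cosSeq_pos {α : ℝ} {k i : ℕ} (h0 : 0 ≤ α) (hα : 2 * (k + 1) * α ≤ Real.pi)
    (hi : 2 * i + 1 ≤ k) : 0 < cosSeq α i := by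
  have hi' : (2 * i + 1 : ℝ) ≤ k := by exact_mod_cast hi
  have h1 : (2 * i + 1) * α ≤ k * α := mul_le_mul_of_nonneg_right hi' h0
  refine Real.cos_pos_of_mem_Ioo ⟨?_, ?_⟩
  · have : 0 ≤ (2 * i + 1) * α := by positivity
    linarith [Real.pi_pos]
  · rcases h0.eq_or_lt with h | h
    · rw [← h]; simp [Real.pi_pos]
    · linarith

theorem cosSeq_nonneg {α : ℝ} {k i : ℕ} (h0 : 0 ≤ α) (hα : 2 * (k + 1) * α ≤ Real.pi)
    (hi : 2 * i ≤ k) : 0 ≤ cosSeq α i := by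
  have hi' : (2 * i : ℝ) ≤ k := by exact_mod_cast hi
  have h1 : (2 * i + 1) * α ≤ (k + 1) * α := mul_le_mul_of_nonneg_right (by linarith) h0
  refine Real.cos_nonneg_of_mem_Icc ⟨?_, by linarith⟩
  have : 0 ≤ (2 * i + 1) * α := by positivity
  linarith [Real.pi_pos]

end CosSeq

/-! ### Rows of the Laplacian and orthogonality to constants -/

section Laplacian

variable {V : Type*} [Fintype V] [DecidableEq V] {G : SimpleGraph V} [DecidableRel G.Adj]

theorem lapMatrix_mulVec_of_forall_adj_iff_eq {v a : V} (h : ∀ u, G.Adj v u ↔ u = a) (Y : V → ℝ) :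
    (G.lapMatrix ℝ *ᵥ Y) v = Y v - Y a := by
  have hn : G.neighborFinset v = {a} := by ext u; simp [h]
  rw [SimpleGraph.lapMatrix_mulVec_apply, ← SimpleGraph.card_neighborFinset_eq_degree, hn]
  simp

theorem lapMatrix_mulVec_of_forall_adj_iff_eq_or {v a b : V} (hab : a ≠ b)
    (h : ∀ u, G.Adj v u ↔ u = a ∨ u = b) (Y : V → ℝ) :
    (G.lapMatrix ℝ *ᵥ Y) v = 2 * Y v - Y a - Y b := by
  have hn : G.neighborFinset v = {a, b} := by ext u; simp [h]
  rw [SimpleGraph.lapMatrix_mulVec_apply, ← SimpleGraph.card_neighborFinset_eq_degree, hn,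
    Finset.card_pair hab, Finset.sum_pair hab]
  push_cast
  ring

/-- The Laplacian is symmetric and kills constants, so an eigenvector with nonzero eigenvalue is
orthogonal to them. -/
theorem sum_eq_zero_of_lapMatrix_mulVec_eq {μ : ℝ} (hμ : μ ≠ 0) {Y : V → ℝ}
    (h : G.lapMatrix ℝ *ᵥ Y = μ • Y) : ∑ v, Y v = 0 := by
  have h1 : (fun _ => (1 : ℝ)) ⬝ᵥ G.lapMatrix ℝ *ᵥ Y = 0 := by
    rw [dotProduct_mulVec, ← mulVec_transpose, (SimpleGraph.isSymm_lapMatrix (R := ℝ) G).eq,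
      SimpleGraph.lapMatrix_mulVec_const_eq_zero, zero_dotProduct]
  rw [h, dotProduct_smul, smul_eq_mul, mul_eq_zero, or_iff_right hμ] at h1
  simpa [dotProduct] using h1

end Laplacian

/-! ### Fiedler vectors of `treeT n k` and the characteristic set -/

section FiedlerT

variable {n k : ℕ}

open Classical in
theorem treeT_dotProduct_lapMatrix_mulVec_le (hkn : k + 1 ≤ n) (x : Fin n → ℝ) :
    x ⬝ᵥ (treeT n k).lapMatrix ℝ *ᵥ x ≤
      ∑ j : Fin n, if (j : ℕ) ≠ 0 then (x (parent hkn j) - x j) ^ 2 else 0 := by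
  rw [← toLinearMap₂'_apply', SimpleGraph.lapMatrix_toLinearMap₂']
  have hle : ∀ i j : Fin n, (if (treeT n k).Adj i j then (x i - x j) ^ 2 else 0) ≤
      (if i = parent hkn j then (if (j : ℕ) ≠ 0 then (x i - x j) ^ 2 else 0) else 0) +
      (if j = parent hkn i then (if (i : ℕ) ≠ 0 then (x j - x i) ^ 2 else 0) else 0) := by
    intro i j
    have h1 := sq_nonneg (x i - x j)
    have h2 := sq_nonneg (x j - x i)
    by_cases h : (treeT n k).Adj i j
    · rw [if_pos h]
      rcases treeT_edge_eq hkn h with ⟨h0, h'⟩ | ⟨h0, h'⟩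
      · rw [if_pos h', if_pos h0]
        refine le_add_of_nonneg_right ?_
        split_ifs <;> positivity
      · rw [if_pos h', if_pos h0, show (x i - x j) ^ 2 = (x j - x i) ^ 2 by ring]
        refine le_add_of_nonneg_left ?_
        split_ifs <;> positivity
    · rw [if_neg h]
      split_ifs <;> positivity
  have hs := Finset.sum_le_sum fun i (_ : i ∈ Finset.univ) =>
    Finset.sum_le_sum fun j (_ : j ∈ Finset.univ) => hle i j
  simp only [Finset.sum_add_distrib] at hs
  rw [Finset.sum_comm (f := fun i j => if i = parent hkn j then _ else _)] at hs
  simp only [Finset.sum_ite_eq', Finset.mem_univ, if_true] at hs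
  linarith

theorem sum_fin_eq_sum_range_of_zero (hkn : k + 1 ≤ n) (F : ℕ → ℝ) (hF : ∀ j, k < j → F j = 0) :
    ∑ j : Fin n, F j = ∑ i ∈ Finset.range (k + 1), F i := by
  rw [Fin.sum_univ_eq_sum_range]
  refine (Finset.sum_subset (Finset.range_mono hkn) fun j _ hj => hF j ?_).symm
  simpa using hj

/-- The algebraic connectivity of `T_{n,k}` is at most that of the path with `k + 1` vertices. -/
theorem eigenvalue_treeT_le [DecidableRel (treeT n k).Adj] (hk : 3 ≤ k) (hkn : k + 1 ≤ n) {μ : ℝ} (hμ : 0 < μ)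
    (h : ∀ u w : Fin n → ℝ, ∃ a b : ℝ, (a ≠ 0 ∨ b ≠ 0) ∧
      μ * ((a • u + b • w) ⬝ᵥ (a • u + b • w)) ≤
        (a • u + b • w) ⬝ᵥ (treeT n k).lapMatrix ℝ *ᵥ (a • u + b • w)) :
    μ ≤ 2 - 2 * Real.cos (Real.pi / (k + 1)) := by
  set α : ℝ := Real.pi / (k + 1) / 2 with hα
  have h2α : 2 * α = Real.pi / (k + 1) := by rw [hα]; ring
  have hkα : 2 * (k + 1) * α = Real.pi := by rw [hα]; field_simp
  have hα0 : 0 ≤ α := by positivity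
  -- The end condition at the far end of the path: the two angles are `π - α` and `π + α`.
  have hsym : cosSeq α k - cosSeq α (k + 1) = 0 := by
    have e1 : (2 * (k : ℝ) + 1) * α = Real.pi - α := by linarith
    have e2 : (2 * ((k + 1 : ℕ) : ℝ) + 1) * α = α + Real.pi := by push_cast; linarith
    rw [cosSeq, cosSeq, e1, e2, Real.cos_pi_sub, Real.cos_add_pi, sub_self]
  set m : ℝ := 2 - 2 * Real.cos (2 * α) with hm
  rw [← h2α, ← hm]
  by_contra! hlt
  -- Pendant vertices copy the hub, so pendant edges add nothing to the quadratic form and only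
  -- increase the norm. On the path the two test vectors are orthogonal by `hsum`, so no combination
  -- has Rayleigh quotient above `m`.
  let p : ℕ → ℕ := fun i => if i ≤ k then i else k / 2
  obtain ⟨a, b, hab, hle⟩ := h (fun _ => 1) (fun v => cosSeq α (p v))
  set x : Fin n → ℝ := a • (fun _ => (1 : ℝ)) + b • fun v : Fin n => cosSeq α (p v) with hx
  have hxv : ∀ v : Fin n, x v = a + b * cosSeq α (p v) := fun v => by simp [hx]
  set S := ∑ i ∈ Finset.range (k + 1), cosSeq α i ^ 2 with hS
  have hquad : x ⬝ᵥ (treeT n k).lapMatrix ℝ *ᵥ x ≤ b ^ 2 * (m * S) := by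
    have h1 := treeT_dotProduct_lapMatrix_mulVec_le hkn x
    have h2 : ∀ j : Fin n, (if (j : ℕ) ≠ 0 then (x (parent hkn j) - x j) ^ 2 else 0) =
        (fun j : ℕ => if j ≠ 0 ∧ j ≤ k then b ^ 2 * (cosSeq α (j - 1) - cosSeq α j) ^ 2 else 0)
          (j : ℕ) := by
      intro j
      simp only [hxv, p, parent_val]
      by_cases hj : (j : ℕ) ≤ k
      · have hj1 : (j : ℕ) - 1 ≤ k := by omega
        by_cases h0 : (j : ℕ) = 0
        · simp [h0]
        · simp only [hj, hj1, if_true, and_true]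
          congr 1
          ring
      · simp [hj, show k / 2 ≤ k by omega]
    rw [Finset.sum_congr rfl fun j _ => h2 j, sum_fin_eq_sum_range_of_zero hkn
      (fun j : ℕ => if j ≠ 0 ∧ j ≤ k then b ^ 2 * (cosSeq α (j - 1) - cosSeq α j) ^ 2 else 0)
      fun j hj => if_neg (by omega), Finset.sum_range_succ'] at h1
    have h3 : ∑ i ∈ Finset.range k, (if i + 1 ≠ 0 ∧ i + 1 ≤ k then
        b ^ 2 * (cosSeq α (i + 1 - 1) - cosSeq α (i + 1)) ^ 2 else 0) = b ^ 2 * (m * S) := by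
      rw [← sub_zero (m * S), ← mul_zero (cosSeq α k), ← hsym, hm, hS, ← sum_sq_cosSeq,
        Finset.mul_sum]
      refine Finset.sum_congr rfl fun i hi => ?_
      rw [if_pos ⟨by omega, by simpa using hi⟩, Nat.add_sub_cancel]
    rw [h3] at h1
    simp only [ne_eq, not_true_eq_false, false_and, if_false, add_zero] at h1
    convert h1
  have hm0 : m ≠ 0 := by
    have hlt : Real.cos (2 * α) < Real.cos 0 := by
      refine Real.cos_lt_cos_of_nonneg_of_le_pi le_rfl ?_ ?_
      · rw [h2α]
        exact div_le_self Real.pi_pos.le (by linarith [(Nat.cast_nonneg k : (0 : ℝ) ≤ k)])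
      · rw [h2α]; positivity
    rw [Real.cos_zero] at hlt
    exact (by linarith : 0 < m).ne'
  have hsum : ∑ i ∈ Finset.range (k + 1), cosSeq α i = 0 := by
    have := sum_cosSeq α k
    rw [hsym, ← hm, mul_eq_zero, or_iff_right hm0] at this
    exact this
  have hnorm : (k + 1) * a ^ 2 + b ^ 2 * S ≤ x ⬝ᵥ x := by
    have h1 : ∑ j : Fin n, (fun j : ℕ => if j ≤ k then (a + b * cosSeq α j) ^ 2 else 0) (j : ℕ) ≤
        x ⬝ᵥ x := by
      refine Finset.sum_le_sum fun j _ => ?_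
      simp only [hxv, p]
      split_ifs
      · exact (sq _).le
      · exact mul_self_nonneg _
    rw [sum_fin_eq_sum_range_of_zero hkn
      (fun j : ℕ => if j ≤ k then (a + b * cosSeq α j) ^ 2 else 0)
      fun j hj => if_neg (by omega)] at h1
    refine le_trans (le_of_eq ?_) h1
    have h2 : ∀ i ∈ Finset.range (k + 1), (if i ≤ k then (a + b * cosSeq α i) ^ 2 else 0) =
        a ^ 2 + 2 * a * b * cosSeq α i + b ^ 2 * cosSeq α i ^ 2 := by
      intro i hi
      rw [if_pos (by simpa [Nat.lt_succ_iff] using hi)]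
      ring
    rw [Finset.sum_congr rfl h2, Finset.sum_add_distrib, Finset.sum_add_distrib, ← Finset.mul_sum,
      ← Finset.mul_sum, hsum, Finset.sum_const, Finset.card_range, nsmul_eq_mul]
    push_cast
    ring
  have hSpos : 0 < S := by
    have hc : 0 < cosSeq α 0 := cosSeq_pos hα0 hkα.le (by omega)
    exact Finset.sum_pos' (fun i _ => sq_nonneg _) ⟨0, by simp, by positivity⟩
  have h1 := mul_le_mul_of_nonneg_left hnorm hμ.le
  have h2 : μ * ((k + 1) * a ^ 2) + (μ - m) * S * b ^ 2 ≤ 0 := by linarith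
  have h3 : 0 < μ - m := by linarith
  rcases hab with h | h
  · have : 0 < a ^ 2 := by positivity
    have : 0 < μ * ((k + 1) * a ^ 2) := by positivity
    have : 0 ≤ (μ - m) * S * b ^ 2 := by positivity
    linarith
  · have : 0 < b ^ 2 := by positivity
    have : 0 ≤ μ * ((k + 1) * a ^ 2) := by positivity
    have : 0 < (μ - m) * S * b ^ 2 := by positivity
    linarith

/-- The angle is `arccos (1 - μ / 2) / 2`. Since `k ≥ 3`, `2α ≤ π / 4 < π / 3`, whence `cos 2α > 1 /
2`; this makes the factor `2 cos 2α - 1` at pendant vertices positive. -/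
theorem exists_half_angle (hk : 3 ≤ k) {μ : ℝ} (h0 : 0 < μ)
    (h : μ ≤ 2 - 2 * Real.cos (Real.pi / (k + 1))) :
    ∃ α : ℝ, 0 ≤ α ∧ 2 * (k + 1) * α ≤ Real.pi ∧ 1 / 2 < Real.cos (2 * α) ∧
      0 < Real.cos α ∧ μ = 2 - 2 * Real.cos (2 * α) := by
  have hk' : (3 : ℝ) ≤ k := by exact_mod_cast hk
  have hpi := Real.pi_pos
  have hcos : Real.cos (2 * (Real.arccos (1 - μ / 2) / 2)) = 1 - μ / 2 := by
    rw [mul_div_cancel₀ _ two_ne_zero]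
    have := Real.neg_one_le_cos (Real.pi / (k + 1))
    exact Real.cos_arccos (by linarith) (by linarith)
  have hle : Real.arccos (1 - μ / 2) ≤ Real.pi / (k + 1) := by
    rw [← Real.arccos_cos (x := Real.pi / (k + 1)) (by positivity)
      (div_le_self hpi.le (by linarith))]
    exact Real.arccos_le_arccos (by linarith)
  have hnn := Real.arccos_nonneg (1 - μ / 2)
  have hle' := (le_div_iff₀ (by positivity)).1 hle
  set α := Real.arccos (1 - μ / 2) / 2 with hα
  have h2 : Real.arccos (1 - μ / 2) = 2 * α := by rw [hα]; ring
  rw [h2] at hle' hnn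
  have h4 : 2 * α * 4 ≤ Real.pi :=
    (mul_le_mul_of_nonneg_left (by linarith) hnn).trans hle'
  refine ⟨α, by linarith, by linarith, ?_, Real.cos_pos_of_mem_Ioo ⟨by linarith, by linarith⟩,
    by linarith⟩
  rw [← Real.cos_pi_div_three]
  exact Real.cos_lt_cos_of_nonneg_of_le_pi hnn (by linarith) (by linarith)

/-- An eigenvector of the Laplacian of `T_{n,k}` is a multiple of `cosSeq` on each half of the path,
and its value on the pendant vertices is determined by the value at the hub. -/
theorem eigenvector_treeT [DecidableRel (treeT n k).Adj] (hk : 3 ≤ k) (hkn : k + 1 ≤ n)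
    {Y : Fin n → ℝ} {α : ℝ} (hα : Real.cos α ≠ 0)
    (hY : (treeT n k).lapMatrix ℝ *ᵥ Y = (2 - 2 * Real.cos (2 * α)) • Y) :
    ∃ A B : ℝ, (∀ v : Fin n, (v : ℕ) ≤ k / 2 → Y v = A * cosSeq α v) ∧
      (∀ v : Fin n, k / 2 ≤ (v : ℕ) → (v : ℕ) ≤ k → Y v = B * cosSeq α (k - v)) ∧
      ∀ v : Fin n, k < (v : ℕ) → (2 * Real.cos (2 * α) - 1) * Y v = Y (hub hkn) := by
  have hv : ∀ v, ((treeT n k).lapMatrix ℝ *ᵥ Y) v = (2 - 2 * Real.cos (2 * α)) * Y v :=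
    fun v => by rw [hY]; rfl
  let y : ℕ → ℝ := fun i => if h : i < n then Y ⟨i, h⟩ else 0
  have hy : ∀ (i : ℕ) (h : i < n), Y ⟨i, h⟩ = y i := fun i h => by simp [y, h]
  have hfirst : y 1 = (2 * Real.cos (2 * α) - 1) * y 0 := by
    have h1 := hv ⟨0, by omega⟩
    rw [lapMatrix_mulVec_of_forall_adj_iff_eq (a := ⟨1, by omega⟩) fun u => by
      rw [treeT_adj, Fin.ext_iff]; simp only; omega, hy, hy] at h1
    linarith
  have hlast : y (k - 1) = (2 * Real.cos (2 * α) - 1) * y k := by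
    have h1 := hv ⟨k, by omega⟩
    rw [lapMatrix_mulVec_of_forall_adj_iff_eq (a := ⟨k - 1, by omega⟩) fun u => by
      rw [treeT_adj, Fin.ext_iff]; simp only; omega, hy, hy] at h1
    linarith
  -- The hub is excluded because pendant vertices may raise its degree above two.
  have hmid : ∀ i, i + 2 ≤ k → i + 1 ≠ k / 2 →
      y i + y (i + 2) = 2 * Real.cos (2 * α) * y (i + 1) := by
    intro i hi hi'
    have h1 := hv ⟨i + 1, by omega⟩
    rw [lapMatrix_mulVec_of_forall_adj_iff_eq_or (a := ⟨i, by omega⟩) (b := ⟨i + 2, by omega⟩)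
      (by rw [ne_eq, Fin.ext_iff]; simp only; omega)
      fun u => by rw [treeT_adj, Fin.ext_iff, Fin.ext_iff]; simp only; omega,
      hy, hy, hy] at h1
    linarith
  have hA := eq_mul_cosSeq hα (y := y) (N := k / 2) (by omega) hfirst fun i hi => by
    have := hmid i (by omega) (by omega)
    linarith
  -- The right half is read backwards, from the end `k` towards the hub.
  have hB := eq_mul_cosSeq hα (y := fun i => y (k - i)) (N := k - k / 2) (by omega) hlast
    fun i hi => by
      have := hmid (k - (i + 2)) (by omega) (by omega)
      rw [show k - (i + 2) + 2 = k - i by omega, show k - (i + 2) + 1 = k - (i + 1) by omega] at this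
      linarith
  refine ⟨y 0 / Real.cos α, y (k - 0) / Real.cos α, fun v hvk => (hy v v.2).trans (hA v hvk), fun v h1 h2 => ?_, fun v hvk => ?_⟩
  · have := hB (k - v) (by omega)
    rw [← this, show k - (k - (v : ℕ)) = v by omega]
    exact hy v v.2
  · have h1 := hv v
    rw [lapMatrix_mulVec_of_forall_adj_iff_eq (a := hub hkn) fun u => by
      rw [treeT_adj, Fin.ext_iff, hub]; simp only; omega] at h1
    linarith

theorem hub_mem_charSet (hk : 3 ≤ k) (hkn : k + 1 ≤ n) {Y : Fin n → ℝ}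
    (hY : IsFiedlerVector (treeT n k) Y) : hub hkn ∈ charSet (treeT n k) Y := by
  classical
  obtain ⟨μ, hμ, hLY, hray⟩ := hY.exists_eigenvalue (treeT_connected hk hkn)
  obtain ⟨α, hα0, hαk, hcos, hα, rfl⟩ := exists_half_angle hk hμ (eigenvalue_treeT_le hk hkn hμ hray)
  have hsum := sum_eq_zero_of_lapMatrix_mulVec_eq hμ.ne' hLY
  obtain ⟨A, B, hA, hB, hP⟩ := eigenvector_treeT hk hkn hα.ne' hLY
  have hpos : ∀ i, 2 * i + 1 ≤ k → 0 < cosSeq α i := fun i hi => cosSeq_pos hα0 hαk hi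
  have hhubA : Y (hub hkn) = A * cosSeq α (k / 2) := hA _ le_rfl
  have hhubB : Y (hub hkn) = B * cosSeq α (k - k / 2) := hB _ le_rfl (by simp [hub]; omega)
  have hzero : ¬ (A = 0 ∧ B = 0) := by
    rintro ⟨rfl, rfl⟩
    refine hY.1 (funext fun v => ?_)
    rcases le_or_gt (v : ℕ) (k / 2) with h | h
    · rw [hA v h, zero_mul]; rfl
    rcases le_or_gt (v : ℕ) k with h' | h'
    · rw [hB v h.le h', zero_mul]; rfl
    · have := hP v h'
      rw [hhubA, zero_mul, mul_eq_zero, or_iff_right (by linarith)] at this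
      exact this
  have hright : (k / 2 + 1 : ℕ) < n := by omega
  have hadj : (treeT n k).Adj (hub hkn) ⟨k / 2 + 1, hright⟩ := by
    rw [treeT_adj]; exact Or.inl (Or.inl ⟨rfl, by simp only; omega⟩)
  have hYr : Y ⟨k / 2 + 1, hright⟩ = B * cosSeq α (k - k / 2 - 1) := by
    rw [hB ⟨k / 2 + 1, hright⟩ (by simp) (by simp only; omega)]
    simp only [Nat.sub_sub]
  have hr := hpos (k - k / 2 - 1) (by omega)
  have h0 := hpos 0 (by omega)
  rcases lt_or_ge 0 (cosSeq α (k / 2)) with hc | hc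
  · have hAB : B = 0 → A = 0 := by
      rintro rfl
      rw [hhubA, zero_mul, mul_eq_zero] at hhubB
      exact hhubB.resolve_right hc.ne'
    have hB0 : B ≠ 0 := fun h => hzero ⟨hAB h, h⟩
    rcases lt_or_ge (cosSeq α (k - k / 2)) 0 with hc' | hc'
    -- The right half already changes sign, and only its last step, the edge at the hub, allows
    -- this.
    · refine Or.inr ⟨⟨k / 2 + 1, hright⟩, hadj, ?_⟩
      rw [hhubB, hYr, show B * cosSeq α (k - k / 2) * (B * cosSeq α (k - k / 2 - 1)) =
        B ^ 2 * (cosSeq α (k - k / 2) * cosSeq α (k - k / 2 - 1)) by ring]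
      exact mul_neg_of_pos_of_neg (by positivity) (mul_neg_of_neg_of_pos hc' hr)
    · exfalso
      have hBh : 0 ≤ B * Y (hub hkn) := by
        rw [hhubB, ← mul_assoc]
        exact mul_nonneg (mul_self_nonneg B) hc'
      have hBA : 0 ≤ B * A := by
        rw [hhubA, ← mul_assoc] at hBh
        exact nonneg_of_mul_nonneg_left hBh hc
      -- Without a sign change all entries have the sign of `B`. As they sum to `0` they all vanish,
      -- contradicting the value `B * cos α` at the end `k`.
      have hnn : ∀ v, 0 ≤ B * Y v := by
        intro v
        rcases le_or_gt (v : ℕ) (k / 2) with h | h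
        · rw [hA v h, ← mul_assoc]
          exact mul_nonneg hBA (cosSeq_nonneg hα0 hαk (by omega))
        rcases le_or_gt (v : ℕ) k with h' | h'
        · rw [hB v h.le h', ← mul_assoc]
          exact mul_nonneg (mul_self_nonneg B) (cosSeq_nonneg hα0 hαk (by omega))
        · rw [← hP v h', mul_left_comm] at hBh
          exact nonneg_of_mul_nonneg_right hBh (by linarith)
      have hs : ∑ v, B * Y v = 0 := by rw [← Finset.mul_sum, hsum, mul_zero]
      have hk0 := (Finset.sum_eq_zero_iff_of_nonneg fun v _ => hnn v).1 hs ⟨k, by omega⟩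
        (Finset.mem_univ _)
      rw [hB ⟨k, by omega⟩ (by simp only; omega) le_rfl] at hk0
      simp only [Nat.sub_self, mul_eq_zero, hB0, h0.ne', or_self] at hk0
  -- Here `k` is even and `Y` vanishes at the hub; a half with nonzero coefficient supplies a
  -- neighbour where `Y` does not vanish.
  · have hkc : k = 2 * (k / 2) := by
      by_contra h
      exact hc.not_gt (hpos _ (by omega))
    have hc0 : cosSeq α (k / 2) = 0 := le_antisymm hc (cosSeq_nonneg hα0 hαk (by omega))
    refine Or.inl ⟨by rw [hhubA, hc0, mul_zero], ?_⟩
    by_cases hB0 : B = 0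
    · have hA0 : A ≠ 0 := fun h => hzero ⟨h, hB0⟩
      have hleft : k / 2 - 1 < n := by omega
      refine ⟨⟨k / 2 - 1, hleft⟩, ?_, ?_⟩
      · rw [treeT_adj]
        exact Or.inr (Or.inl ⟨by simp only [hub]; omega, by simp only [hub]; omega⟩)
      · rw [hA ⟨k / 2 - 1, hleft⟩ (by simp)]
        exact mul_ne_zero hA0 (hpos (k / 2 - 1) (by omega)).ne'
    · exact ⟨_, hadj, by rw [hYr]; exact mul_ne_zero hB0 hr.ne'⟩

end FiedlerT

end TreeCentralParts

theorem mainTheorem9 (n k : ℕ) (hk : 3 ≤ k) (hkn : k + 1 ≤ n) :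
    -- `T_{n,k}` is a tree on `n` vertices with diameter `k`, and it has a Fiedler vector
    (TreeCentralParts.treeT n k ∈ TreeCentralParts.treesOfDiam n k ∧
      ∃ Y, TreeCentralParts.IsFiedlerVector (TreeCentralParts.treeT n k) Y) ∧
    -- all pairwise distances between the central parts of `T_{n,k}` are zero
    (TreeCentralParts.setDist (TreeCentralParts.treeT n k)
        (TreeCentralParts.treeT n k).center
        (TreeCentralParts.centroid (TreeCentralParts.treeT n k)) = 0 ∧
      TreeCentralParts.setDist (TreeCentralParts.treeT n k)
        (TreeCentralParts.treeT n k).center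
        (TreeCentralParts.subtreeCore (TreeCentralParts.treeT n k)) = 0 ∧
      TreeCentralParts.setDist (TreeCentralParts.treeT n k)
        (TreeCentralParts.centroid (TreeCentralParts.treeT n k))
        (TreeCentralParts.subtreeCore (TreeCentralParts.treeT n k)) = 0 ∧
      ∀ Y, TreeCentralParts.IsFiedlerVector (TreeCentralParts.treeT n k) Y →
        TreeCentralParts.setDist (TreeCentralParts.treeT n k)
          (TreeCentralParts.treeT n k).center
          (TreeCentralParts.charSet (TreeCentralParts.treeT n k) Y) = 0 ∧
        TreeCentralParts.setDist (TreeCentralParts.treeT n k)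
          (TreeCentralParts.centroid (TreeCentralParts.treeT n k))
          (TreeCentralParts.charSet (TreeCentralParts.treeT n k) Y) = 0 ∧
        TreeCentralParts.setDist (TreeCentralParts.treeT n k)
          (TreeCentralParts.charSet (TreeCentralParts.treeT n k) Y)
          (TreeCentralParts.subtreeCore (TreeCentralParts.treeT n k)) = 0) ∧
    -- over all trees on `n` vertices with diameter `k`, the minimum distances are zero
    (IsLeast {d | ∃ T ∈ TreeCentralParts.treesOfDiam n k,
        d = TreeCentralParts.setDist T T.center (TreeCentralParts.centroid T)} 0 ∧
      IsLeast {d | ∃ T ∈ TreeCentralParts.treesOfDiam n k,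
        d = TreeCentralParts.setDist T T.center (TreeCentralParts.subtreeCore T)} 0 ∧
      IsLeast {d | ∃ T ∈ TreeCentralParts.treesOfDiam n k,
        d = TreeCentralParts.setDist T (TreeCentralParts.centroid T)
          (TreeCentralParts.subtreeCore T)} 0 ∧
      IsLeast {d | ∃ T ∈ TreeCentralParts.treesOfDiam n k,
        ∃ Y, TreeCentralParts.IsFiedlerVector T Y ∧
          d = TreeCentralParts.setDist T T.center (TreeCentralParts.charSet T Y)} 0 ∧
      IsLeast {d | ∃ T ∈ TreeCentralParts.treesOfDiam n k,
        ∃ Y, TreeCentralParts.IsFiedlerVector T Y ∧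
          d = TreeCentralParts.setDist T (TreeCentralParts.centroid T)
            (TreeCentralParts.charSet T Y)} 0 ∧
      IsLeast {d | ∃ T ∈ TreeCentralParts.treesOfDiam n k,
        ∃ Y, TreeCentralParts.IsFiedlerVector T Y ∧
          d = TreeCentralParts.setDist T (TreeCentralParts.charSet T Y)
            (TreeCentralParts.subtreeCore T)} 0) := by
  have hmem : TreeCentralParts.treeT n k ∈ TreeCentralParts.treesOfDiam n k :=
    ⟨TreeCentralParts.treeT_isTree hk hkn, TreeCentralParts.treeT_diam hk hkn⟩
  obtain ⟨Y, hY⟩ := TreeCentralParts.exists_isFiedlerVector (TreeCentralParts.treeT n k)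
    (by rw [Fintype.card_fin]; omega)
  have hC := TreeCentralParts.hub_mem_center hk hkn
  have hD := TreeCentralParts.hub_mem_centroid hk hkn
  have hS := TreeCentralParts.hub_mem_subtreeCore hk hkn
  have hX := fun Y (hY : TreeCentralParts.IsFiedlerVector (TreeCentralParts.treeT n k) Y) =>
    TreeCentralParts.hub_mem_charSet hk hkn hY
  exact ⟨⟨hmem, Y, hY⟩,
    ⟨TreeCentralParts.setDist_eq_zero hC hD, TreeCentralParts.setDist_eq_zero hC hS,
      TreeCentralParts.setDist_eq_zero hD hS, fun Y hY =>
        ⟨TreeCentralParts.setDist_eq_zero hC (hX Y hY),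
          TreeCentralParts.setDist_eq_zero hD (hX Y hY),
          TreeCentralParts.setDist_eq_zero (hX Y hY) hS⟩⟩,
    ⟨⟨_, hmem, (TreeCentralParts.setDist_eq_zero hC hD).symm⟩, fun _ _ => zero_le⟩,
    ⟨⟨_, hmem, (TreeCentralParts.setDist_eq_zero hC hS).symm⟩, fun _ _ => zero_le⟩,
    ⟨⟨_, hmem, (TreeCentralParts.setDist_eq_zero hD hS).symm⟩, fun _ _ => zero_le⟩,
    ⟨⟨_, hmem, Y, hY, (TreeCentralParts.setDist_eq_zero hC (hX Y hY)).symm⟩, fun _ _ => zero_le⟩,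
    ⟨⟨_, hmem, Y, hY, (TreeCentralParts.setDist_eq_zero hD (hX Y hY)).symm⟩, fun _ _ => zero_le⟩,
    ⟨⟨_, hmem, Y, hY, (TreeCentralParts.setDist_eq_zero (hX Y hY) hS).symm⟩, fun _ _ => zero_le⟩⟩
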